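/- A \emph{tile} is a closed, simply connected polygon in $\mathbb R^2$ all of whose sides are parallel to the coordinate axes; it is \emph{tall} if its height is $1$. A \emph{tiling} of a region $\Gamma\subset\mathbb R^2$ with a finite set $T$ of tiles is a collection of translates of tiles of $T$ whose interiors are pairwise disjoint and whose union is $\Gamma$. A function $f:\mathbb N\to\mathbb N$, where $\mathbb N=\{0,1,2,\dots\}$, is a \emph{tile counting function} if there are a real number $\varepsilon\ge 0$ and a finite set $T$ of tall tiles such that, for every $n\in\mathbb N$, $f(n)$ is the number of tilings with $T$ of the rectangle $[0,n+\varepsilon]\times[0,1]$ (a rectangle of length $0$ being regarded as the empty region, which has exactly one tiling, the empty one). For a prime $p$ and an integer $m\geq 1$ put $\operatorname{ord}_p(m)=\max\{d\ge 0: p^d\mid m\}$, and let $C_n=\frac1{n+1}\binom{2n}{n}$ be the $n$-th Catalan number. For every prime $p$ there exists a tile counting function $f$ with $f(n)\ge 1$ and $\operatorname{ord}_p(f(n))=\operatorname{ord}_p(C_n)$ for all $n\in\mathbb N$. Moreover, one such function is $$f(n)=\binom{2n}{n}+\left(p^{2n}-1\right)\binom{2n}{n+1}.$$ -/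

import Mathlib

namespace IrrationalTiling

/-- A tile: an axis-parallel simply connected closed polygon in the plane, i.e. a finite union of
nondegenerate closed axis-parallel rectangles which is simply connected and has connected interior.
(Connectedness of the interior excludes pieces that touch only at a corner; together with simple
connectedness it makes the tile a topological closed disc.) -/
structure IsTile (τ : Set (ℝ × ℝ)) : Prop where
  rectilinear : ∃ S : Set (Set (ℝ × ℝ)), S.Finite ∧
    (∀ r ∈ S, ∃ a b c d : ℝ, a < b ∧ c < d ∧ r = Set.Icc a b ×ˢ Set.Icc c d) ∧ τ = ⋃₀ S
  simplyConnected : SimplyConnectedSpace τ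
  interior_connected : IsConnected (interior τ)

/-- A tall tile: a tile of height `1`. -/
structure IsTallTile (τ : Set (ℝ × ℝ)) : Prop extends IsTile τ where
  height_one : ∃ c : ℝ, Prod.snd '' τ = Set.Icc c (c + 1)

/-- `P` is a tiling of the region `Γ` with the set of tiles `T`: a collection of translates of
tiles of `T`, non-overlapping (the interiors are pairwise disjoint), whose union is `Γ`. -/
structure IsTiling (T : Set (Set (ℝ × ℝ))) (Γ : Set (ℝ × ℝ)) (P : Set (Set (ℝ × ℝ))) : Prop where
  translates : ∀ A ∈ P, ∃ τ ∈ T, ∃ v : ℝ × ℝ, A = (fun z => v + z) '' τ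
  nonoverlapping : P.Pairwise fun A B => Disjoint (interior A) (interior B)
  covers : ⋃₀ P = Γ

/-- The number of tilings of `Γ` with `T`. -/
noncomputable def numTilings (T : Set (Set (ℝ × ℝ))) (Γ : Set (ℝ × ℝ)) : ℕ∞ :=
  {P : Set (Set (ℝ × ℝ)) | IsTiling T Γ P}.encard

open Classical in
/-- The rectangle `[1 × a]` of height `1` and length `a`. The degenerate rectangle of length `0`
is the empty region (it has exactly one tiling by tiles, the empty one). -/
noncomputable def rect (a : ℝ) : Set (ℝ × ℝ) :=
  if 0 < a then Set.Icc 0 a ×ˢ Set.Icc 0 1 else ∅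

/-- `f` is a tile counting function: for some fixed `ε ≥ 0` and some finite set `T` of tall tiles,
`f n` is the number of tilings of `[1 × (n + ε)]` with `T`, for all `n`. -/
def IsTileCountingFunction (f : ℕ → ℕ) : Prop :=
  ∃ (ε : ℝ) (T : Set (Set (ℝ × ℝ))), 0 ≤ ε ∧ T.Finite ∧ (∀ τ ∈ T, IsTallTile τ) ∧
    ∀ n : ℕ, (f n : ℕ∞) = numTilings T (rect (n + ε))

/-- The function `n ↦ binom(2n, n) + (p^(2n) - 1) * binom(2n, n + 1)`. The subtraction does not
truncate when `p` is positive. -/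
def catalanLike (p n : ℕ) : ℕ :=
  (2 * n).choose n + (p ^ (2 * n) - 1) * (2 * n).choose (n + 1)

end IrrationalTiling

namespace IrrationalTiling

/-- The data of a tall tile which is the union of a lower rectangle of length `len` and an upper
rectangle whose left and right sides are displaced by `left` and `right`. -/
@[ext]
structure TileSpec where
  left : ℝ
  right : ℝ
  len : ℝ

namespace TileSpec

/-- The tile described by `s`, its lower left corner being at `(x, 0)`. -/
def shape (x : ℝ) (s : TileSpec) : Set (ℝ × ℝ) :=
  Set.Icc x (x + s.len) ×ˢ Set.Icc 0 (1 / 2) ∪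
    Set.Icc (x + s.left) (x + s.len + s.right) ×ˢ Set.Icc (1 / 2) 1

/-- The displacements are nonnegative and small compared with the length. -/
structure Good (s : TileSpec) : Prop where
  left_nonneg : 0 ≤ s.left
  left_le : s.left ≤ 1 / 16
  right_nonneg : 0 ≤ s.right
  right_le : s.right ≤ 1 / 16
  le_len : 1 / 4 ≤ s.len

theorem mem_shape {x : ℝ} {s : TileSpec} {z : ℝ × ℝ} :
    z ∈ s.shape x ↔ ((x ≤ z.1 ∧ z.1 ≤ x + s.len) ∧ 0 ≤ z.2 ∧ z.2 ≤ 1 / 2) ∨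
      ((x + s.left ≤ z.1 ∧ z.1 ≤ x + s.len + s.right) ∧ 1 / 2 ≤ z.2 ∧ z.2 ≤ 1) := by
  simp only [shape, Set.mem_union, Set.mem_prod, Set.mem_Icc]

theorem mem_shape_bottom {x : ℝ} {s : TileSpec} {t : ℝ} :
    (t, (0 : ℝ)) ∈ s.shape x ↔ x ≤ t ∧ t ≤ x + s.len := by
  rw [mem_shape]; norm_num

theorem mem_shape_top {x : ℝ} {s : TileSpec} {t : ℝ} :
    (t, (1 : ℝ)) ∈ s.shape x ↔ x + s.left ≤ t ∧ t ≤ x + s.len + s.right := by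
  rw [mem_shape]; norm_num

theorem translate_shape (x y : ℝ) (s : TileSpec) :
    (fun z => (x, (0 : ℝ)) + z) '' s.shape y = s.shape (x + y) := by
  ext z
  simp only [Set.mem_image, mem_shape, Prod.exists]
  constructor
  · rintro ⟨a, b, h, rfl⟩
    simp only [Prod.mk_add_mk, zero_add]
    rcases h with ⟨⟨_, _⟩, _⟩ | ⟨⟨_, _⟩, _⟩
    · left; refine ⟨⟨by linarith, by linarith⟩, ‹_›⟩
    · right; refine ⟨⟨by linarith, by linarith⟩, ‹_›⟩
  · intro h
    refine ⟨z.1 - x, z.2, ?_, by ext <;> simp⟩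
    rcases h with ⟨⟨_, _⟩, _⟩ | ⟨⟨_, _⟩, _⟩
    · left; refine ⟨⟨by linarith, by linarith⟩, ‹_›⟩
    · right; refine ⟨⟨by linarith, by linarith⟩, ‹_›⟩

theorem Good.shape_injective {x y : ℝ} {s t : TileSpec} (hs : s.Good) (ht : t.Good)
    (h : s.shape x = t.shape y) : x = y ∧ s = t := by
  obtain ⟨s1, s2, s3, s4, s5⟩ := hs
  obtain ⟨t1, t2, t3, t4, t5⟩ := ht
  have hb : Set.Icc x (x + s.len) = Set.Icc y (y + t.len) := by
    ext a
    rw [Set.mem_Icc, Set.mem_Icc, ← mem_shape_bottom, ← mem_shape_bottom, h]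
  have ht : Set.Icc (x + s.left) (x + s.len + s.right) =
      Set.Icc (y + t.left) (y + t.len + t.right) := by
    ext a
    rw [Set.mem_Icc, Set.mem_Icc, ← mem_shape_top, ← mem_shape_top, h]
  obtain ⟨b1, b2⟩ := (Set.Icc_eq_Icc_iff (by linarith)).1 hb
  obtain ⟨u1, u2⟩ := (Set.Icc_eq_Icc_iff (by linarith)).1 ht
  refine ⟨b1, TileSpec.ext ?_ ?_ ?_⟩ <;> linarith

theorem Good.isTallTile {s : TileSpec} (hs : s.Good) : IsTallTile (s.shape 0) := by
  obtain ⟨s1, s2, s3, s4, s5⟩ := hs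
  refine ⟨⟨?_, ?_, ?_⟩, 0, ?_⟩
  · refine ⟨{Set.Icc 0 (0 + s.len) ×ˢ Set.Icc 0 (1 / 2),
      Set.Icc (0 + s.left) (0 + s.len + s.right) ×ˢ Set.Icc (1 / 2) 1}, by simp, ?_, ?_⟩
    · rintro r (rfl | rfl)
      · exact ⟨_, _, _, _, by linarith, by norm_num, rfl⟩
      · exact ⟨_, _, _, _, by linarith, by norm_num, rfl⟩
    · rw [Set.sUnion_pair, shape]
  · have hc : StarConvex ℝ ((1 / 8, 1 / 2) : ℝ × ℝ) (s.shape 0) := by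
      refine StarConvex.union ?_ ?_
      · refine ((convex_Icc _ _).prod (convex_Icc _ _)).starConvex ?_
        simp only [Set.mem_prod, Set.mem_Icc]
        refine ⟨⟨?_, ?_⟩, ?_, ?_⟩ <;> linarith
      · refine ((convex_Icc _ _).prod (convex_Icc _ _)).starConvex ?_
        simp only [Set.mem_prod, Set.mem_Icc]
        refine ⟨⟨?_, ?_⟩, ?_, ?_⟩ <;> linarith
    have : ContractibleSpace (s.shape 0) := by
      refine hc.contractibleSpace ⟨(1 / 8, 1 / 2), ?_⟩
      rw [mem_shape]
      left
      refine ⟨⟨?_, ?_⟩, ?_, ?_⟩ <;> simp only [] <;> linarith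
    infer_instance
  · set A : Set (ℝ × ℝ) := Set.Ioo 0 (0 + s.len) ×ˢ Set.Ioo 0 (1 / 2) with hA
    set B : Set (ℝ × ℝ) :=
      Set.Ioo (0 + s.left) (0 + s.len + s.right) ×ˢ Set.Ioo (1 / 2) 1 with hB
    set C : Set (ℝ × ℝ) := Set.Ioo s.left s.len ×ˢ Set.Ioo 0 1 with hC
    have cA : IsPreconnected A := ((convex_Ioo _ _).prod (convex_Ioo _ _)).isPreconnected
    have cB : IsPreconnected B := ((convex_Ioo _ _).prod (convex_Ioo _ _)).isPreconnected
    have cC : IsPreconnected C := ((convex_Ioo _ _).prod (convex_Ioo _ _)).isPreconnected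
    have oU : IsOpen (A ∪ C ∪ B) := ((isOpen_Ioo.prod isOpen_Ioo).union
      (isOpen_Ioo.prod isOpen_Ioo)).union (isOpen_Ioo.prod isOpen_Ioo)
    have hU : IsPreconnected (A ∪ C ∪ B) := by
      refine IsPreconnected.union (1 / 8, 3 / 4) (Or.inr ?_) ?_
        (IsPreconnected.union (1 / 8, 1 / 4) ?_ ?_ cA cC) cB
      all_goals
        simp only [hA, hB, hC, Set.mem_prod, Set.mem_Ioo]
        refine ⟨⟨?_, ?_⟩, ?_, ?_⟩ <;> linarith
    have hsub : A ∪ C ∪ B ⊆ s.shape 0 := by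
      rintro ⟨a, b⟩ h
      rw [mem_shape]
      simp only [hA, hB, hC, Set.mem_union, Set.mem_prod, Set.mem_Ioo] at h ⊢
      rcases h with (⟨⟨_, _⟩, _, _⟩ | ⟨⟨_, _⟩, _, _⟩) | ⟨⟨_, _⟩, _, _⟩
      · left; refine ⟨⟨?_, ?_⟩, ?_, ?_⟩ <;> linarith
      · rcases le_total b (1 / 2) with hb | hb
        · left; refine ⟨⟨?_, ?_⟩, ?_, ?_⟩ <;> linarith
        · right; refine ⟨⟨?_, ?_⟩, ?_, ?_⟩ <;> linarith
      · right; refine ⟨⟨?_, ?_⟩, ?_, ?_⟩ <;> linarith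
    have hcl : s.shape 0 ⊆ closure (A ∪ C ∪ B) := by
      have clA : closure A = Set.Icc 0 (0 + s.len) ×ˢ Set.Icc 0 (1 / 2) := by
        rw [hA, closure_prod_eq, closure_Ioo (by linarith), closure_Ioo (by norm_num)]
      have clB : closure B =
          Set.Icc (0 + s.left) (0 + s.len + s.right) ×ˢ Set.Icc (1 / 2) 1 := by
        rw [hB, closure_prod_eq, closure_Ioo (by linarith), closure_Ioo (by norm_num)]
      rw [closure_union, closure_union, clA, clB]
      rintro z (h | h)
      · exact Or.inl (Or.inl h)
      · exact Or.inr h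
    have hint : A ∪ C ∪ B ⊆ interior (s.shape 0) := oU.subset_interior_iff.2 hsub
    refine ⟨⟨(1 / 8, 1 / 4), hint (Or.inl (Or.inl ?_))⟩,
      hU.subset_closure hint (interior_subset.trans hcl)⟩
    simp only [hA, Set.mem_prod, Set.mem_Ioo]
    refine ⟨⟨?_, ?_⟩, ?_, ?_⟩ <;> linarith
  · ext y
    simp only [Set.mem_image, Prod.exists, exists_eq_right, mem_shape, Set.mem_Icc]
    constructor
    · rintro ⟨a, ⟨_, _, _⟩ | ⟨_, _, _⟩⟩ <;> constructor <;> linarith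
    · rintro ⟨h0, h1⟩
      refine ⟨1 / 8, ?_⟩
      rcases le_total y (1 / 2) with hb | hb
      · left; refine ⟨⟨?_, ?_⟩, ?_, ?_⟩ <;> linarith
      · right; refine ⟨⟨?_, ?_⟩, ?_, ?_⟩ <;> linarith

theorem interior_bottom_subset (x : ℝ) (s : TileSpec) :
    Set.Ioo x (x + s.len) ×ˢ Set.Ioo 0 (1 / 2) ⊆ interior (s.shape x) :=
  (isOpen_Ioo.prod isOpen_Ioo).subset_interior_iff.2 <| Set.subset_union_of_subset_left
    (Set.prod_mono Set.Ioo_subset_Icc_self Set.Ioo_subset_Icc_self) _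

theorem interior_top_subset (x : ℝ) (s : TileSpec) :
    Set.Ioo (x + s.left) (x + s.len + s.right) ×ˢ Set.Ioo (1 / 2) 1 ⊆ interior (s.shape x) :=
  (isOpen_Ioo.prod isOpen_Ioo).subset_interior_iff.2 <| Set.subset_union_of_subset_right
    (Set.prod_mono Set.Ioo_subset_Icc_self Set.Ioo_subset_Icc_self) _

theorem disjoint_interior_of_le {x y : ℝ} {s t : TileSpec} (hb : x + s.len ≤ y)
    (ht : x + s.len + s.right ≤ y + t.left) :
    Disjoint (interior (s.shape x)) (interior (t.shape y)) := by
  rw [Set.disjoint_iff_inter_eq_empty, ← interior_inter]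
  have hsub : s.shape x ∩ t.shape y ⊆
      ({y} ×ˢ Set.univ ∪ {y + t.left} ×ˢ Set.univ) ∪ Set.univ ×ˢ {1 / 2} := by
    rintro ⟨a, b⟩ ⟨h1, h2⟩
    rw [mem_shape] at h1 h2
    simp only [Set.mem_union, Set.mem_prod, Set.mem_singleton_iff, Set.mem_univ, and_true,
      true_and] at h1 h2 ⊢
    rcases h1 with ⟨⟨_, _⟩, _, _⟩ | ⟨⟨_, _⟩, _, _⟩ <;>
      rcases h2 with ⟨⟨_, _⟩, _, _⟩ | ⟨⟨_, _⟩, _, _⟩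
    · left; left; linarith
    · right; linarith
    · right; linarith
    · left; right; linarith
  refine Set.subset_empty_iff.1 ((interior_mono hsub).trans ?_)
  rw [interior_union_isClosed_of_interior_empty, interior_union_isClosed_of_interior_empty]
  · simp [interior_prod_eq]
  · exact isClosed_singleton.prod isClosed_univ
  · simp [interior_prod_eq]
  · exact (isClosed_singleton.prod isClosed_univ).union (isClosed_singleton.prod isClosed_univ)
  · simp [interior_prod_eq]

theorem le_or_le_of_disjoint_interior {x y : ℝ} {s t : TileSpec} (hs : s.Good) (ht : t.Good)
    (h : Disjoint (interior (s.shape x)) (interior (t.shape y))) :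
    (x + s.len ≤ y ∨ y + t.len ≤ x) ∧
      (x + s.len + s.right ≤ y + t.left ∨ y + t.len + t.right ≤ x + s.left) := by
  obtain ⟨s1, s2, s3, s4, s5⟩ := hs
  obtain ⟨t1, t2, t3, t4, t5⟩ := ht
  have key : ∀ {a b c d : ℝ}, a < b → c < d → (∀ r, ¬ (r ∈ Set.Ioo a b ∧ r ∈ Set.Ioo c d)) →
      b ≤ c ∨ d ≤ a := by
    intro a b c d hab hcd hr
    by_contra! hh
    have : max a c < min b d := by simp [hab, hcd, hh]
    obtain ⟨r, h1, h2⟩ := exists_between this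
    rw [max_lt_iff] at h1
    rw [lt_min_iff] at h2
    exact hr r ⟨⟨h1.1, h2.1⟩, h1.2, h2.2⟩
  constructor
  · refine key (by linarith) (by linarith) fun r ⟨hr, hr'⟩ => ?_
    exact Set.disjoint_left.1 h
      (interior_bottom_subset x s (a := (r, 1 / 4)) ⟨hr, by norm_num, by norm_num⟩)
      (interior_bottom_subset y t ⟨hr', by norm_num, by norm_num⟩)
  · refine key (by linarith) (by linarith) fun r ⟨hr, hr'⟩ => ?_
    exact Set.disjoint_left.1 h
      (interior_top_subset x s (a := (r, 3 / 4)) ⟨hr, by norm_num, by norm_num⟩)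
      (interior_top_subset y t ⟨hr', by norm_num, by norm_num⟩)

/-- `w` is a list of specs from `S` in which each left displacement is the preceding right one,
the first left displacement is `u` and the last right displacement is `0`. -/
def IsPath (S : Set TileSpec) : ℝ → List TileSpec → Prop
  | u, [] => u = 0
  | u, s :: w => s ∈ S ∧ s.left = u ∧ IsPath S s.right w

/-- The total length of a list of specs. -/
def total (w : List TileSpec) : ℝ := (w.map len).sum

@[simp] theorem total_nil : total [] = 0 := rfl

@[simp] theorem total_cons (s : TileSpec) (w : List TileSpec) :
    total (s :: w) = s.len + total w := by simp [total]

@[simp] theorem total_append (v w : List TileSpec) : total (v ++ w) = total v + total w := by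
  simp [total]

/-- The positions of the tiles of a list laid out one after the other, beginning at `x`. -/
def place : ℝ → List TileSpec → Set (ℝ × TileSpec)
  | _, [] => ∅
  | x, s :: w => insert (x, s) (place (x + s.len) w)

/-- `Q` fills the part of the strip that lies to the left of `L` and to the right of the broken
line which is at `x` in the lower half and at `x + u` in the upper half. -/
structure Fills (S : Set TileSpec) (L x u : ℝ) (Q : Set (ℝ × TileSpec)) : Prop where
  le_bottom : x ≤ L
  le_top : x + u ≤ L
  mem : ∀ q ∈ Q, q.2 ∈ S
  left_bottom : ∀ q ∈ Q, x ≤ q.1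
  left_top : ∀ q ∈ Q, x + u ≤ q.1 + q.2.left
  right_bottom : ∀ q ∈ Q, q.1 + q.2.len ≤ L
  right_top : ∀ q ∈ Q, q.1 + q.2.len + q.2.right ≤ L
  disj_bottom : ∀ q ∈ Q, ∀ r ∈ Q, q ≠ r → q.1 + q.2.len ≤ r.1 ∨ r.1 + r.2.len ≤ q.1
  disj_top : ∀ q ∈ Q, ∀ r ∈ Q, q ≠ r → q.1 + q.2.len + q.2.right ≤ r.1 + r.2.left ∨
    r.1 + r.2.len + r.2.right ≤ q.1 + q.2.left
  cover_bottom : ∀ t, x < t → t < L → ∃ q ∈ Q, q.1 ≤ t ∧ t ≤ q.1 + q.2.len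
  cover_top : ∀ t, x + u < t → t < L →
    ∃ q ∈ Q, q.1 + q.2.left ≤ t ∧ t ≤ q.1 + q.2.len + q.2.right

variable {S : Set TileSpec} {L x u : ℝ} {Q : Set (ℝ × TileSpec)}

theorem Fills.exists_first (hS : ∀ s ∈ S, s.Good) (h : Fills S L x u Q) (hx : x < L) :
    ∃ s, (x, s) ∈ Q := by
  obtain ⟨t, ht1, ht2⟩ := exists_between (lt_min hx (show x < x + 1 / 4 by linarith))
  rw [lt_min_iff] at ht2
  obtain ⟨q, hq, hq1, hq2⟩ := h.cover_bottom t ht1 ht2.1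
  rcases (h.left_bottom q hq).eq_or_lt with he | hlt
  · exact ⟨q.2, by rw [he]; exact hq⟩
  · obtain ⟨t', ht1', ht2'⟩ := exists_between hlt
    obtain ⟨r, hr, hr1, hr2⟩ := h.cover_bottom t' ht1' (by linarith)
    have hne : q ≠ r := by rintro rfl; linarith
    have := (hS _ (h.mem q hq)).le_len
    have := (hS _ (h.mem r hr)).le_len
    have := h.left_bottom r hr
    rcases h.disj_bottom q hq r hr hne with h' | h' <;> linarith

theorem Fills.first_left (hS : ∀ s ∈ S, s.Good) (h : Fills S L x u Q) {s : TileSpec}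
    (hs : (x, s) ∈ Q) : s.left = u := by
  have h1 := h.left_top _ hs
  have h2 := h.right_top _ hs
  have g := hS _ (h.mem _ hs)
  have := g.left_le
  have := g.right_nonneg
  have := g.le_len
  simp only at *
  by_contra hne
  have hlt : u < s.left := lt_of_le_of_ne (by linarith) (Ne.symm hne)
  obtain ⟨t, ht1, ht2⟩ := exists_between hlt
  obtain ⟨r, hr, hr1, hr2⟩ := h.cover_top (x + t) (by linarith) (by linarith)
  have hne : (x, s) ≠ r := by rintro rfl; simp only at hr1; linarith
  have gr := hS _ (h.mem _ hr)
  have := gr.left_nonneg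
  have := gr.le_len
  have := h.left_bottom r hr
  rcases h.disj_bottom _ hs r hr hne with h' | h' <;> simp only at h' <;> linarith

theorem Fills.remove_first (hS : ∀ s ∈ S, s.Good) (h : Fills S L x u Q) {s : TileSpec}
    (hs : (x, s) ∈ Q) : Fills S L (x + s.len) s.right (Q \ {(x, s)}) where
  le_bottom := h.right_bottom _ hs
  le_top := h.right_top _ hs
  mem q hq := h.mem q hq.1
  left_bottom q hq := by
    have := h.left_bottom q hq.1
    have := (hS _ (h.mem q hq.1)).le_len
    rcases h.disj_bottom _ hs q hq.1 (Ne.symm hq.2) with h' | h' <;> simp only at h' <;> linarith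
  left_top q hq := by
    have := h.left_bottom q hq.1
    have g := hS _ (h.mem q hq.1)
    have := g.le_len
    have := g.right_nonneg
    have := (hS _ (h.mem _ hs)).left_le
    rcases h.disj_top _ hs q hq.1 (Ne.symm hq.2) with h' | h' <;> simp only at * <;> linarith
  right_bottom q hq := h.right_bottom q hq.1
  right_top q hq := h.right_top q hq.1
  disj_bottom q hq r hr := h.disj_bottom q hq.1 r hr.1
  disj_top q hq r hr := h.disj_top q hq.1 r hr.1
  cover_bottom t ht1 ht2 := by
    have := (hS _ (h.mem _ hs)).le_len
    simp only at this
    obtain ⟨q, hq, hq1, hq2⟩ := h.cover_bottom t (by linarith) ht2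
    refine ⟨q, ⟨hq, ?_⟩, hq1, hq2⟩
    rintro rfl
    simp only at hq2
    linarith
  cover_top t ht1 ht2 := by
    have g := hS _ (h.mem _ hs)
    have := g.le_len
    have := g.right_nonneg
    have := g.left_le
    have := h.left_top _ hs
    simp only at *
    obtain ⟨q, hq, hq1, hq2⟩ := h.cover_top t (by linarith) ht2
    refine ⟨q, ⟨hq, ?_⟩, hq1, hq2⟩
    rintro rfl
    simp only at hq2
    linarith

theorem Fills.exists_path (hS : ∀ s ∈ S, s.Good) (h : Fills S L x u Q) :
    ∃ w, IsPath S u w ∧ x + total w = L ∧ Q = place x w := by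
  obtain ⟨n, hn⟩ := exists_nat_gt ((L - x) * 4)
  induction n generalizing x u Q with
  | zero =>
    have := h.le_bottom
    push_cast at hn
    linarith
  | succ n ih =>
    rcases h.le_bottom.eq_or_lt with rfl | hlt
    · have hQ : Q = ∅ := by
        refine Set.eq_empty_of_forall_notMem fun q hq => ?_
        have := h.left_bottom q hq
        have := h.right_bottom q hq
        have := (hS _ (h.mem _ hq)).le_len
        linarith
      refine ⟨[], ?_, by simp, hQ⟩
      by_contra hu
      have hu' : u < 0 := lt_of_le_of_ne (by linarith [h.le_top]) hu
      obtain ⟨q, hq, -⟩ := h.cover_top (x + u / 2) (by linarith) (by linarith)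
      simp [hQ] at hq
    · obtain ⟨s, hs⟩ := h.exists_first hS hlt
      have := (hS _ (h.mem _ hs)).le_len
      simp only at this
      obtain ⟨w, hw1, hw2, hw3⟩ := ih (h.remove_first hS hs) (by push_cast at hn; linarith)
      refine ⟨s :: w, ⟨h.mem _ hs, h.first_left hS hs, hw1⟩, ?_, ?_⟩
      · rw [total_cons]; linarith
      · rw [place, ← hw3, Set.insert_sdiff_singleton, Set.insert_eq_of_mem hs]

theorem IsPath.total_nonneg (hS : ∀ s ∈ S, s.Good) {w : List TileSpec} (hw : IsPath S u w) :
    0 ≤ total w := by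
  induction w generalizing u with
  | nil => simp
  | cons s w ih =>
    have := ih hw.2.2
    have := (hS s hw.1).le_len
    rw [total_cons]
    linarith

theorem IsPath.total_top (hS : ∀ s ∈ S, s.Good) {w : List TileSpec} (hw : IsPath S u w) :
    u ≤ total w := by
  induction w generalizing u with
  | nil => exact le_of_eq hw
  | cons s w ih =>
    have := hw.2.2.total_nonneg hS
    have := (hS s hw.1).le_len
    have := (hS s hw.1).left_le
    have := hw.2.1
    rw [total_cons]
    linarith

theorem IsPath.fills (hS : ∀ s ∈ S, s.Good) {w : List TileSpec} (hw : IsPath S u w)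
    (x : ℝ) : Fills S (x + total w) x u (place x w) := by
  induction w generalizing x u with
  | nil =>
    obtain rfl : u = 0 := hw
    constructor <;> simp [place] <;> intros <;> linarith
  | cons s w ih =>
    obtain ⟨hs, rfl, hw⟩ := hw
    have h := ih hw (x + s.len)
    have g := hS s hs
    have g1 := g.left_nonneg
    have g2 := g.left_le
    have g3 := g.right_nonneg
    have g4 := g.le_len
    have t1 := hw.total_nonneg hS
    have t2 := hw.total_top hS
    rw [add_assoc, ← total_cons] at h
    refine ⟨?_, ?_, ?_, ?_, ?_, ?_, ?_, ?_, ?_, ?_, ?_⟩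
    · rw [total_cons]; linarith
    · rw [total_cons]; linarith
    · rintro q (rfl | hq)
      exacts [hs, h.mem q hq]
    · rintro q (rfl | hq)
      exacts [le_rfl, by linarith [h.left_bottom q hq]]
    · rintro q (rfl | hq)
      exacts [le_rfl, by linarith [h.left_top q hq]]
    · rintro q (rfl | hq)
      exacts [h.le_bottom, h.right_bottom q hq]
    · rintro q (rfl | hq)
      exacts [h.le_top, h.right_top q hq]
    · rintro q (rfl | hq) r (rfl | hr) hne
      · exact absurd rfl hne
      · exact Or.inl (h.left_bottom r hr)
      · exact Or.inr (h.left_bottom q hq)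
      · exact h.disj_bottom q hq r hr hne
    · rintro q (rfl | hq) r (rfl | hr) hne
      · exact absurd rfl hne
      · exact Or.inl (h.left_top r hr)
      · exact Or.inr (h.left_top q hq)
      · exact h.disj_top q hq r hr hne
    · intro t ht1 ht2
      rcases le_or_gt t (x + s.len) with ht | ht
      · exact ⟨_, Or.inl rfl, ht1.le, ht⟩
      · obtain ⟨q, hq, hq'⟩ := h.cover_bottom t ht ht2
        exact ⟨q, Or.inr hq, hq'⟩
    · intro t ht1 ht2
      rcases le_or_gt t (x + s.len + s.right) with ht | ht
      · exact ⟨_, Or.inl rfl, ht1.le, ht⟩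
      · obtain ⟨q, hq, hq'⟩ := h.cover_top t ht ht2
        exact ⟨q, Or.inr hq, hq'⟩

theorem place_finite (x : ℝ) (w : List TileSpec) : (place x w).Finite := by
  induction w generalizing x with
  | nil => exact Set.finite_empty
  | cons s w ih => exact (ih _).insert _

theorem IsPath.place_injective (hS : ∀ s ∈ S, s.Good) {v w : List TileSpec} {u' : ℝ}
    (hv : IsPath S u v) (hw : IsPath S u' w) (h : place x v = place x w) : v = w := by
  induction v generalizing x u u' w with
  | nil =>
    cases w with
    | nil => rfl
    | cons t w => exact absurd h.symm (Set.insert_nonempty _ _).ne_empty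
  | cons s v ih =>
    cases w with
    | nil => exact absurd h (Set.insert_nonempty _ _).ne_empty
    | cons t w =>
      have hs := (hS s hv.1).le_len
      have ht := (hS t hw.1).le_len
      have nv : ∀ r, (x, r) ∉ place (x + s.len) v := fun r hr => by
        have := (hv.2.2.fills hS (x + s.len)).left_bottom _ hr
        simp only at this
        linarith
      have nw : ∀ r, (x, r) ∉ place (x + t.len) w := fun r hr => by
        have := (hw.2.2.fills hS (x + t.len)).left_bottom _ hr
        simp only at this
        linarith
      have hst : s = t := by
        have : (x, s) ∈ place x (t :: w) := h ▸ Set.mem_insert _ _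
        rcases this with h' | h'
        · exact congrArg Prod.snd h'
        · exact absurd h' (nw s)
      subst hst
      have : place (x + s.len) v = place (x + s.len) w := by
        rw [place, place] at h
        rw [← Set.insert_sdiff_self_of_notMem (nv s), h, Set.insert_sdiff_self_of_notMem (nw s)]
      rw [ih hv.2.2 hw.2.2 this]

/-- The tiles placed according to `Q`. -/
def tiles (Q : Set (ℝ × TileSpec)) : Set (Set (ℝ × ℝ)) := (fun q => q.2.shape q.1) '' Q

theorem tiles_injective (hS : ∀ s ∈ S, s.Good) {R : Set (ℝ × TileSpec)}
    (hQ : ∀ q ∈ Q, q.2 ∈ S) (hR : ∀ q ∈ R, q.2 ∈ S) (h : tiles Q = tiles R) : Q = R := by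
  have key : ∀ {Q R : Set (ℝ × TileSpec)}, (∀ q ∈ Q, q.2 ∈ S) → (∀ q ∈ R, q.2 ∈ S) →
      tiles Q = tiles R → Q ⊆ R := by
    intro Q R hQ hR h q hq
    have hm : q.2.shape q.1 ∈ tiles R := h ▸ Set.mem_image_of_mem _ hq
    obtain ⟨r, hr, he⟩ := hm
    obtain ⟨h1, h2⟩ := (hS _ (hR r hr)).shape_injective (hS _ (hQ q hq)) he
    rwa [← Prod.ext h1 h2]
  exact (key hQ hR h).antisymm (key hR hQ h.symm)

theorem Fills.isTiling (hS : ∀ s ∈ S, s.Good) (hL : 0 < L) (hQ : Q.Finite)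
    (h : Fills S L 0 0 Q) : IsTiling (shape 0 '' S) (rect L) (tiles Q) where
  translates := by
    rintro _ ⟨q, hq, rfl⟩
    refine ⟨_, Set.mem_image_of_mem _ (h.mem q hq), (q.1, 0), ?_⟩
    rw [translate_shape, add_zero]
  nonoverlapping := by
    rintro _ ⟨q, hq, rfl⟩ _ ⟨r, hr, rfl⟩ hne
    have hne' : q ≠ r := by rintro rfl; exact hne rfl
    have gq := hS _ (h.mem q hq)
    have gr := hS _ (h.mem r hr)
    have := gq.le_len
    have := gr.le_len
    have := gq.left_nonneg
    have := gr.left_nonneg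
    have := gq.left_le
    have := gr.left_le
    have := gq.right_nonneg
    have := gr.right_nonneg
    rcases h.disj_bottom q hq r hr hne' with hb | hb <;>
      rcases h.disj_top q hq r hr hne' with ht | ht
    · exact disjoint_interior_of_le hb ht
    · linarith
    · linarith
    · exact (disjoint_interior_of_le hb ht).symm
  covers := by
    rw [rect, if_pos hL]
    apply Set.Subset.antisymm
    · rintro z ⟨_, ⟨q, hq, rfl⟩, hz⟩
      have h1 := h.left_bottom q hq
      have h2 := h.left_top q hq
      have h3 := h.right_bottom q hq
      have h4 := h.right_top q hq
      rw [mem_shape] at hz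
      rcases hz with ⟨⟨_, _⟩, _, _⟩ | ⟨⟨_, _⟩, _, _⟩ <;>
        refine ⟨⟨?_, ?_⟩, ?_, ?_⟩ <;> linarith
    · have hcl : IsClosed (⋃₀ tiles Q) := by
        rw [tiles, Set.sUnion_image]
        refine hQ.isClosed_biUnion fun q _ => ?_
        exact (isClosed_Icc.prod isClosed_Icc).union (isClosed_Icc.prod isClosed_Icc)
      have hI : Set.Icc 0 L ×ˢ Set.Icc (0 : ℝ) 1 = closure (Set.Ioo 0 L ×ˢ Set.Ioo (0 : ℝ) 1) := by
        rw [closure_prod_eq, closure_Ioo hL.ne, closure_Ioo (by norm_num)]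
      rw [hI]
      refine hcl.closure_subset_iff.2 ?_
      rintro ⟨a, b⟩ ⟨⟨ha1, ha2⟩, hb1, hb2⟩
      simp only at ha1 ha2 hb1 hb2
      rcases le_total b (1 / 2) with hb | hb
      · obtain ⟨q, hq, hq'⟩ := h.cover_bottom a ha1 ha2
        exact ⟨_, ⟨q, hq, rfl⟩, mem_shape.2 (Or.inl ⟨hq', hb1.le, hb⟩)⟩
      · obtain ⟨q, hq, hq'⟩ := h.cover_top a (by linarith) ha2
        exact ⟨_, ⟨q, hq, rfl⟩, mem_shape.2 (Or.inr ⟨hq', hb, hb2.le⟩)⟩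

theorem exists_fills_of_isTiling (hS : ∀ s ∈ S, s.Good) (hL : 0 < L) {P : Set (Set (ℝ × ℝ))}
    (hP : IsTiling (shape 0 '' S) (rect L) P) : ∃ Q, Fills S L 0 0 Q ∧ P = tiles Q := by
  have hrect : rect L = Set.Icc 0 L ×ˢ Set.Icc 0 1 := by rw [rect, if_pos hL]
  have hsub : ∀ A ∈ P, A ⊆ Set.Icc 0 L ×ˢ Set.Icc 0 1 := fun A hA => by
    rw [← hrect, ← hP.covers]; exact Set.subset_sUnion_of_mem hA
  set Q : Set (ℝ × TileSpec) := {q | q.2 ∈ S ∧ q.2.shape q.1 ∈ P} with hQ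
  have hPQ : P = tiles Q := by
    apply Set.Subset.antisymm
    · intro A hA
      obtain ⟨_, ⟨s, hs, rfl⟩, ⟨v1, v2⟩, hAv⟩ := hP.translates A hA
      have g := (hS s hs).le_len
      have b0 : ((v1, v2) : ℝ × ℝ) + (0, 0) ∈ A := by
        rw [hAv]
        exact Set.mem_image_of_mem _ (mem_shape_bottom.2 ⟨le_rfl, by linarith⟩)
      have b1 : ((v1, v2) : ℝ × ℝ) + (s.left, 1) ∈ A := by
        rw [hAv]
        have := (hS s hs).left_le
        have := (hS s hs).right_nonneg
        exact Set.mem_image_of_mem _ (mem_shape_top.2 ⟨by linarith, by linarith⟩)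
      have c0 := (hsub A hA b0).2.1
      have c1 := (hsub A hA b1).2.2
      simp only [Prod.mk_add_mk] at c0 c1
      obtain rfl : v2 = 0 := by linarith
      rw [translate_shape, add_zero] at hAv
      exact ⟨(v1, s), ⟨hs, hAv ▸ hA⟩, hAv.symm⟩
    · rintro _ ⟨q, hq, rfl⟩
      exact hq.2
  have hne : ∀ q ∈ Q, ∀ r ∈ Q, q ≠ r →
      Disjoint (interior (q.2.shape q.1)) (interior (r.2.shape r.1)) := by
    intro q hq r hr hqr
    refine hP.nonoverlapping hq.2 hr.2 fun he => hqr ?_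
    obtain ⟨h1, h2⟩ := (hS _ hq.1).shape_injective (hS _ hr.1) he
    exact Prod.ext h1 h2
  have hbot : ∀ q ∈ Q, ∀ t, q.1 ≤ t → t ≤ q.1 + q.2.len → 0 ≤ t ∧ t ≤ L :=
    fun q hq t h1 h2 => (hsub _ hq.2 (mem_shape_bottom.2 ⟨h1, h2⟩)).1
  have htop : ∀ q ∈ Q, ∀ t, q.1 + q.2.left ≤ t → t ≤ q.1 + q.2.len + q.2.right →
      0 ≤ t ∧ t ≤ L :=
    fun q hq t h1 h2 => (hsub _ hq.2 (mem_shape_top.2 ⟨h1, h2⟩)).1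
  have hlen : ∀ q ∈ Q, q.1 ≤ q.1 + q.2.len := fun q hq => by
    linarith [(hS _ hq.1).le_len]
  have hlen' : ∀ q ∈ Q, q.1 + q.2.left ≤ q.1 + q.2.len + q.2.right := fun q hq => by
    linarith [(hS _ hq.1).le_len, (hS _ hq.1).left_le, (hS _ hq.1).right_nonneg]
  have hcov : ∀ z ∈ rect L, ∃ q ∈ Q, z ∈ q.2.shape q.1 := by
    intro z hz
    rw [← hP.covers, hPQ] at hz
    obtain ⟨_, ⟨q, hq, rfl⟩, hz⟩ := hz
    exact ⟨q, hq, hz⟩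
  refine ⟨Q, ⟨hL.le, by linarith, fun q hq => hq.1, fun q hq => (hbot q hq _ le_rfl (hlen q hq)).1,
    fun q hq => ?_, fun q hq => (hbot q hq _ (hlen q hq) le_rfl).2,
    fun q hq => (htop q hq _ (hlen' q hq) le_rfl).2, fun q hq r hr hqr => ?_,
    fun q hq r hr hqr => ?_, fun t ht1 ht2 => ?_, fun t ht1 ht2 => ?_⟩, hPQ⟩
  · rw [add_zero]
    exact (htop q hq _ le_rfl (hlen' q hq)).1
  · exact (le_or_le_of_disjoint_interior (hS _ hq.1) (hS _ hr.1) (hne q hq r hr hqr)).1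
  · exact (le_or_le_of_disjoint_interior (hS _ hq.1) (hS _ hr.1) (hne q hq r hr hqr)).2
  · obtain ⟨q, hq, hz⟩ := hcov (t, 0) (by
      rw [hrect]; exact ⟨⟨ht1.le, ht2.le⟩, le_rfl, zero_le_one⟩)
    exact ⟨q, hq, mem_shape_bottom.1 hz⟩
  · rw [add_zero] at ht1
    obtain ⟨q, hq, hz⟩ := hcov (t, 1) (by
      rw [hrect]; exact ⟨⟨ht1.le, ht2.le⟩, zero_le_one, le_rfl⟩)
    exact ⟨q, hq, mem_shape_top.1 hz⟩

/-- The tilings of a rectangle correspond to the paths of the total length of the rectangle. -/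
theorem numTilings_eq_encard_paths (hS : ∀ s ∈ S, s.Good) (hL : 0 < L) :
    numTilings (shape 0 '' S) (rect L) = {w | IsPath S 0 w ∧ total w = L}.encard := by
  have himg : {P | IsTiling (shape 0 '' S) (rect L) P} =
      (fun w => tiles (place 0 w)) '' {w | IsPath S 0 w ∧ total w = L} := by
    ext P
    constructor
    · intro hP
      obtain ⟨Q, hQ, rfl⟩ := exists_fills_of_isTiling hS hL hP
      obtain ⟨w, hw1, hw2, rfl⟩ := hQ.exists_path hS
      exact ⟨w, ⟨hw1, by simpa using hw2⟩, rfl⟩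
    · rintro ⟨w, ⟨hw, rfl⟩, rfl⟩
      have := hw.fills hS 0
      rw [zero_add] at this
      exact this.isTiling hS hL (place_finite 0 w)
  rw [numTilings, himg, Set.InjOn.encard_image]
  rintro v ⟨hv, -⟩ w ⟨hw, -⟩ h
  exact hv.place_injective hS hw (tiles_injective hS (hv.fills hS 0).mem (hw.fills hS 0).mem h)

end TileSpec

open TileSpec

theorem int_linearIndependent_sqrt_two_three {a b c : ℤ}
    (h : (a : ℝ) + b * √2 + c * √3 = 0) : a = 0 ∧ b = 0 ∧ c = 0 := by
  have s2 : (√2 : ℝ) ^ 2 = 2 := Real.sq_sqrt (by norm_num)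
  have s3 : (√3 : ℝ) ^ 2 = 3 := Real.sq_sqrt (by norm_num)
  have i2 : Irrational √2 := irrational_sqrt_two
  have i3 : Irrational √3 := by simpa using Nat.prime_three.irrational_sqrt
  have lin : ∀ {r : ℝ}, Irrational r → ∀ x y : ℤ, (x : ℝ) + y * r = 0 → y = 0 := by
    intro r hr x y hxy
    by_contra hy
    exact ((hr.intCast_mul hy).intCast_add x).ne_zero hxy
  have hac : a * c = 0 := by
    have := lin i3 (a ^ 2 + 3 * c ^ 2 - 2 * b ^ 2) (2 * (a * c)) (by
      push_cast
      linear_combination (a + c * √3 - b * √2) * h - c ^ 2 * s3 + b ^ 2 * s2)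
    omega
  rcases mul_eq_zero.1 hac with rfl | rfl
  · have hbc : (2 * b ^ 2 : ℤ) = 3 * c ^ 2 := by
      have : (2 * b ^ 2 : ℝ) = 3 * c ^ 2 := by
        push_cast at h
        linear_combination (b * √2 - c * √3) * h - b ^ 2 * s2 + c ^ 2 * s3
      exact_mod_cast this
    have i6 : Irrational √6 := by
      rw [show (6 : ℝ) = ((6 : ℕ) : ℝ) by norm_num, irrational_sqrt_natCast_iff]
      rintro ⟨r, hr⟩
      have : r ≤ 2 := by nlinarith
      interval_cases r <;> omega
    have s6 : (√6 : ℝ) = √2 * √3 := by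
      rw [← Real.sqrt_mul (by norm_num)]; norm_num
    have hb : b = 0 := by
      have := lin i6 (3 * c) b (by
        push_cast at h ⊢
        rw [s6]
        linear_combination √3 * h - c * s3)
      exact this
    subst hb
    refine ⟨rfl, rfl, ?_⟩
    have : c ^ 2 = 0 := by linarith
    exact pow_eq_zero_iff (two_ne_zero) |>.1 this
  · have hb := lin i2 a b (by simpa using h)
    subst hb
    refine ⟨?_, rfl, rfl⟩
    simpa using h

/-- The displacement that encodes the state `s`. -/
noncomputable def edge (p s : ℕ) : ℝ := (s + 1) / (16 * (p + 1))

theorem edge_pos (p s : ℕ) : 0 < edge p s := by unfold edge; positivity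

theorem edge_le {p s : ℕ} (h : s ≤ p) : edge p s ≤ 1 / 16 := by
  have : (s : ℝ) ≤ p := by exact_mod_cast h
  unfold edge
  rw [div_le_div_iff₀ (by positivity) (by norm_num)]
  linarith

theorem edge_injective (p : ℕ) : Function.Injective (edge p) := by
  intro s t h
  unfold edge at h
  rw [div_left_inj' (by positivity)] at h
  exact_mod_cast add_right_cancel h

/-- The tile that begins a tiling. -/
noncomputable def start (p : ℕ) : TileSpec := ⟨0, edge p 0, √3⟩

/-- The tile that ends a tiling in the state `s`. -/
noncomputable def finish (p s : ℕ) : TileSpec := ⟨edge p s, 0, √3⟩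

/-- The tile for the transition `a` (new state and weight) from the state `s`. -/
noncomputable def middle (p s : ℕ) (a : ℕ × ℤ) : TileSpec :=
  ⟨edge p s, edge p a.1, 1 / 2 + √2 / 100 * a.2⟩

/-- The transitions (new state and weight) from a state. In the state `0` only the colour `0` has
been used; the states `1, …, p` record the last colour after another one has been used. -/
def out (p : ℕ) : ℕ → Finset (ℕ × ℤ)
  | 0 => {0} ×ˢ {1, -1} ∪ Finset.Icc 1 (p - 1) ×ˢ {-1, -3}
  | _ + 1 => Finset.Icc 1 p ×ˢ {1, -1}

theorem out_bounds {p s : ℕ} {a : ℕ × ℤ} (h : a ∈ out p s) : a.1 ≤ p ∧ -3 ≤ a.2 ∧ a.2 ≤ 1 := by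
  cases s <;>
    simp only [out, Finset.mem_union, Finset.mem_product, Finset.mem_singleton, Finset.mem_insert,
      Finset.mem_Icc] at h <;> omega

/-- The tiles used for the prime `p`. -/
def specs (p : ℕ) : Set TileSpec :=
  insert (start p) ((finish p '' Set.Iic p) ∪ ⋃ s ∈ Set.Iic p, middle p s '' (out p s))

theorem specs_finite (p : ℕ) : (specs p).Finite :=
  (((Set.finite_Iic p).image _).union
    ((Set.finite_Iic p).biUnion fun s _ => (out p s).finite_toSet.image _)).insert _

theorem mem_specs {p : ℕ} {x : TileSpec} : x ∈ specs p ↔ x = start p ∨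
    (∃ s ≤ p, x = finish p s) ∨ ∃ s ≤ p, ∃ a ∈ out p s, x = middle p s a := by
  simp only [specs, Set.mem_insert_iff, Set.mem_union, Set.mem_image, Set.mem_iUnion, Set.mem_Iic,
    exists_prop, Finset.mem_coe, eq_comm (a := x)]

theorem specs_good {p : ℕ} : ∀ x ∈ specs p, x.Good := by
  have h3 : 1 / 4 ≤ √3 := Real.le_sqrt_of_sq_le (by norm_num)
  have h2 : √2 ≤ 2 := Real.sqrt_le_iff.2 (by norm_num)
  have h2' : 0 ≤ √2 := Real.sqrt_nonneg 2
  intro x hx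
  rcases mem_specs.1 hx with rfl | ⟨s, hs, rfl⟩ | ⟨s, hs, a, ha, rfl⟩
  · exact ⟨le_rfl, by norm_num [start], (edge_pos _ _).le, edge_le (Nat.zero_le p), h3⟩
  · exact ⟨(edge_pos _ _).le, edge_le hs, le_rfl, by norm_num [finish], h3⟩
  · obtain ⟨h, hk, -⟩ := out_bounds ha
    refine ⟨(edge_pos _ _).le, edge_le hs, (edge_pos _ _).le, edge_le h, ?_⟩
    have : (-3 : ℝ) ≤ a.2 := by exact_mod_cast hk
    simp only [middle]
    nlinarith

/-- The sequences of `m` transitions of total weight `k` from the state `s`. -/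
def words (p : ℕ) : ℕ → ℕ → ℤ → Finset (List (ℕ × ℤ))
  | _, 0, k => if k = 0 then {[]} else ∅
  | s, m + 1, k => (out p s).biUnion fun a => (words p a.1 m (k - a.2)).image (List.cons a)

theorem nil_mem_words (p s : ℕ) : [] ∈ words p s 0 0 := by simp [words]

theorem cons_mem_words {p s m : ℕ} {k : ℤ} {a : ℕ × ℤ} {w : List (ℕ × ℤ)} :
    a :: w ∈ words p s (m + 1) k ↔ a ∈ out p s ∧ w ∈ words p a.1 m (k - a.2) := by
  simp [words]

theorem card_words_succ (p s m : ℕ) (k : ℤ) :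
    (words p s (m + 1) k).card = ∑ a ∈ out p s, (words p a.1 m (k - a.2)).card := by
  rw [words, Finset.card_biUnion]
  · refine Finset.sum_congr rfl fun a _ => Finset.card_image_of_injective _ (List.cons_injective)
  · intro a _ b _ hab
    rw [Function.onFun, Finset.disjoint_left]
    intro w hw hw'
    obtain ⟨v, -, rfl⟩ := Finset.mem_image.1 hw
    obtain ⟨v', -, h⟩ := Finset.mem_image.1 hw'
    exact hab (List.cons.inj h).1.symm

/-- The number of sequences of `m` signs whose sum is `k`. -/
def signCount : ℕ → ℤ → ℕ
  | 0, k => if k = 0 then 1 else 0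
  | m + 1, k => signCount m (k - 1) + signCount m (k + 1)

theorem signCount_choose (m j : ℕ) : signCount m (2 * j - m) = m.choose j := by
  induction m generalizing j with
  | zero => cases j <;> simp [signCount]; omega
  | succ m ih =>
    rw [signCount]
    have h2 := ih j
    rw [show (2 * (j : ℤ) - ((m + 1 : ℕ) : ℤ) + 1) = 2 * j - m by push_cast; ring, h2]
    cases j with
    | zero =>
      have : ∀ (m : ℕ) (k : ℤ), k < -m → signCount m k = 0 := by
        intro m
        induction m with
        | zero => intro k hk; rw [signCount, if_neg]; simp at hk; omega
        | succ m ih =>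
          intro k hk
          push_cast at hk
          rw [signCount, ih _ (by omega), ih _ (by omega)]
      rw [this m _ (by push_cast; omega)]
      simp
    | succ j =>
      rw [Nat.choose_succ_succ, ← ih j]
      congr 2
      push_cast
      ring

theorem card_words_succ_state (p s m : ℕ) (k : ℤ) :
    (words p (s + 1) m k).card = p ^ m * signCount m k := by
  induction m generalizing s k with
  | zero => by_cases hk : k = 0 <;> simp [words, signCount, hk]
  | succ m ih =>
    have hin : ∀ a ∈ Finset.Icc 1 p, ∑ b ∈ ({1, -1} : Finset ℤ), (words p a m (k - b)).card =
        p ^ m * signCount (m + 1) k := by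
      intro a ha
      obtain ⟨a, rfl⟩ : ∃ c, a = c + 1 := ⟨a - 1, by have := (Finset.mem_Icc.1 ha).1; omega⟩
      rw [Finset.sum_pair (by norm_num), ih, ih, signCount, sub_neg_eq_add, mul_add]
    rw [card_words_succ, out, Finset.sum_product, Finset.sum_congr rfl hin]
    simp only [Finset.sum_const, Nat.card_Icc, smul_eq_mul, Nat.add_sub_cancel]
    ring

theorem card_words_zero_state {p : ℕ} (hp : 1 ≤ p) (m : ℕ) (k : ℤ) :
    (words p 0 m k).card = signCount m k + (p ^ m - 1) * signCount m (k + 2) := by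
  induction m generalizing k with
  | zero => by_cases hk : k = 0 <;> simp [words, signCount, hk]
  | succ m ih =>
    have hin : ∀ a ∈ Finset.Icc 1 (p - 1), ∑ b ∈ ({-1, -3} : Finset ℤ),
        (words p a m (k - b)).card = p ^ m * signCount (m + 1) (k + 2) := by
      intro a ha
      obtain ⟨a, rfl⟩ : ∃ c, a = c + 1 := ⟨a - 1, by have := (Finset.mem_Icc.1 ha).1; omega⟩
      rw [Finset.sum_pair (by norm_num), card_words_succ_state, card_words_succ_state, signCount,
        ← mul_add, show k - -1 = k + 2 - 1 by ring, show k - -3 = k + 2 + 1 by ring]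
    rw [card_words_succ, out, Finset.sum_union, Finset.sum_product, Finset.sum_product,
      Finset.sum_singleton, Finset.sum_pair (by norm_num), Finset.sum_congr rfl hin, ih, ih]
    · simp only [Finset.sum_const, Nat.card_Icc, smul_eq_mul, Nat.add_sub_cancel]
      rw [signCount, signCount]
      rw [show k - 1 + 2 = k + 2 - 1 by ring, show k - -1 = k + 1 by ring,
        show k + 1 + 2 = k + 2 + 1 by ring]
      have h1 : 1 ≤ p ^ m := Nat.one_le_pow _ _ hp
      have h2 : 1 ≤ p ^ (m + 1) := Nat.one_le_pow _ _ hp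
      zify [h1, h2, hp]
      ring
    · rw [Finset.disjoint_left]
      rintro ⟨a, b⟩ h h'
      simp only [Finset.mem_product, Finset.mem_singleton, Finset.mem_Icc] at h h'
      omega

theorem card_words_eq_catalanLike {p : ℕ} (hp : 1 ≤ p) (n : ℕ) :
    (words p 0 (2 * n) 0).card = catalanLike p n := by
  rw [card_words_zero_state hp, catalanLike, ← signCount_choose, ← signCount_choose]
  congr 3 <;> push_cast <;> ring

/-- The tiles for a sequence of transitions from the state `s`, and the final tile. -/
noncomputable def mids (p : ℕ) : ℕ → List (ℕ × ℤ) → List TileSpec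
  | s, [] => [finish p s]
  | s, a :: w => middle p s a :: mids p a.1 w

theorem middle_ne_finish (p s : ℕ) (a : ℕ × ℤ) (t : ℕ) : middle p s a ≠ finish p t := fun h =>
  (edge_pos p a.1).ne' (congrArg TileSpec.right h)

theorem middle_injective (p s : ℕ) : Function.Injective (middle p s) := by
  intro a b h
  have h1 := congrArg TileSpec.right h
  have h2 := congrArg TileSpec.len h
  simp only [middle] at h1 h2
  refine Prod.ext (edge_injective p h1) ?_
  have h0 : √2 / 100 ≠ 0 := by positivity
  exact_mod_cast mul_left_cancel₀ h0 (add_left_cancel h2)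

theorem mids_injective (p s : ℕ) : Function.Injective (mids p s) := by
  intro v w h
  induction v generalizing s w with
  | nil =>
    cases w with
    | nil => rfl
    | cons a w => exact absurd (List.cons.inj h).1.symm (middle_ne_finish _ _ _ _)
  | cons a v ih =>
    cases w with
    | nil => exact absurd (List.cons.inj h).1 (middle_ne_finish _ _ _ _)
    | cons b w =>
      obtain ⟨h1, h2⟩ := List.cons.inj h
      obtain rfl := middle_injective p s h1
      rw [ih _ h2]

theorem isPath_mids {p s m : ℕ} {k : ℤ} {w : List (ℕ × ℤ)} (hs : s ≤ p)
    (hw : w ∈ words p s m k) : IsPath (specs p) (edge p s) (mids p s w) := by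
  induction w generalizing s m k with
  | nil => exact ⟨mem_specs.2 (Or.inr (Or.inl ⟨s, hs, rfl⟩)), rfl, rfl⟩
  | cons a w ih =>
    cases m with
    | zero => by_cases hk : k = 0 <;> simp [words, hk] at hw
    | succ m =>
      obtain ⟨ha, hw⟩ := cons_mem_words.1 hw
      exact ⟨mem_specs.2 (Or.inr (Or.inr ⟨s, hs, a, ha, rfl⟩)), rfl, ih (out_bounds ha).1 hw⟩

theorem total_mids {p s m : ℕ} {k : ℤ} {w : List (ℕ × ℤ)} (hw : w ∈ words p s m k) :
    total (mids p s w) = m / 2 + √2 / 100 * k + √3 := by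
  induction w generalizing s m k with
  | nil =>
    cases m with
    | zero =>
      obtain rfl : k = 0 := by by_contra hk; simp [words, hk] at hw
      simp [mids, finish]
    | succ m => simp [words] at hw
  | cons a w ih =>
    cases m with
    | zero => by_cases hk : k = 0 <;> simp [words, hk] at hw
    | succ m =>
      rw [mids, total_cons, ih (cons_mem_words.1 hw).2, middle]
      push_cast
      ring

theorem exists_mids_append {p s : ℕ} {w : List TileSpec}
    (hw : IsPath (specs p) (edge p s) w) : ∃ m k, ∃ v ∈ words p s m k, ∃ r,
      IsPath (specs p) 0 r ∧ w = mids p s v ++ r := by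
  induction w generalizing s with
  | nil => exact absurd hw (edge_pos p s).ne'
  | cons x w ih =>
    obtain ⟨hx, hl, hw⟩ := hw
    rcases mem_specs.1 hx with rfl | ⟨t, ht, rfl⟩ | ⟨t, ht, a, ha, rfl⟩
    · exact absurd hl (edge_pos p s).ne
    · obtain rfl := edge_injective p hl
      exact ⟨0, 0, [], nil_mem_words p t, w, hw, rfl⟩
    · obtain rfl := edge_injective p hl
      obtain ⟨m, k, v, hv, r, hr, rfl⟩ := ih hw
      exact ⟨m + 1, k + a.2, a :: v, cons_mem_words.2 ⟨ha, by simpa using hv⟩, r, hr, rfl⟩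

theorem exists_cons_start {p : ℕ} {w : List TileSpec} (hw : IsPath (specs p) 0 w)
    (hne : w ≠ []) : ∃ v, IsPath (specs p) (edge p 0) v ∧ w = start p :: v := by
  cases w with
  | nil => exact absurd rfl hne
  | cons x w =>
    obtain ⟨hx, hl, hw⟩ := hw
    rcases mem_specs.1 hx with rfl | ⟨t, ht, rfl⟩ | ⟨t, ht, a, ha, rfl⟩
    · exact ⟨w, hw, rfl⟩
    · exact absurd hl (edge_pos p t).ne'
    · exact absurd hl (edge_pos p t).ne'

theorem exists_total_eq {p : ℕ} {u : ℝ} {w : List TileSpec} (hw : IsPath (specs p) u w) :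
    ∃ (m b : ℕ) (k : ℤ), total w = m / 2 + √2 / 100 * k + b * √3 := by
  induction w generalizing u with
  | nil => exact ⟨0, 0, 0, by simp⟩
  | cons x w ih =>
    obtain ⟨m, b, k, h⟩ := ih hw.2.2
    rcases mem_specs.1 hw.1 with rfl | ⟨t, ht, rfl⟩ | ⟨t, ht, a, ha, rfl⟩
    · exact ⟨m, b + 1, k, by rw [total_cons, h, start]; push_cast; ring⟩
    · exact ⟨m, b + 1, k, by rw [total_cons, h, finish]; push_cast; ring⟩
    · exact ⟨m + 1, b, k + a.2, by rw [total_cons, h, middle]; push_cast; ring⟩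

theorem coeff_unique {n m b : ℕ} {k : ℤ}
    (h : (m : ℝ) / 2 + √2 / 100 * k + b * √3 = n + 2 * √3) : m = 2 * n ∧ k = 0 ∧ b = 2 := by
  obtain ⟨h1, h2, h3⟩ := int_linearIndependent_sqrt_two_three
    (a := 50 * m - 100 * n) (b := k) (c := 100 * (b - 2)) (by
      push_cast
      linear_combination 100 * h)
  omega

theorem paths_eq_image (p n : ℕ) :
    {w | IsPath (specs p) 0 w ∧ total w = n + 2 * √3} =
      (fun v => start p :: mids p 0 v) '' (words p 0 (2 * n) 0) := by
  ext w
  constructor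
  · rintro ⟨hw, ht⟩
    have hne : w ≠ [] := by
      rintro rfl
      have : 0 < √3 := by positivity
      rw [total_nil] at ht
      have : (0 : ℝ) ≤ n := n.cast_nonneg
      linarith
    obtain ⟨w, hw', rfl⟩ := exists_cons_start hw hne
    obtain ⟨m, k, v, hv, r, hr, rfl⟩ := exists_mids_append hw'
    rw [total_cons, total_append, total_mids hv, start] at ht
    have hr0 : r = [] := by
      by_contra hrne
      obtain ⟨r', hr', rfl⟩ := exists_cons_start hr hrne
      obtain ⟨m', b', k', htr⟩ := exists_total_eq hr'
      rw [total_cons, htr, start] at ht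
      have := (coeff_unique (n := n) (m := m + m') (b := b' + 3) (k := k + k')
        (by push_cast; linarith)).2.2
      omega
    subst hr0
    obtain ⟨rfl, rfl, -⟩ := coeff_unique (n := n) (m := m) (b := 2) (k := k)
      (by rw [total_nil] at ht; push_cast; linarith)
    exact ⟨v, hv, by simp⟩
  · rintro ⟨v, hv, rfl⟩
    refine ⟨⟨mem_specs.2 (Or.inl rfl), rfl, isPath_mids (Nat.zero_le p) hv⟩, ?_⟩
    rw [total_cons, total_mids hv, start]
    push_cast
    ring

theorem isTileCountingFunction_catalanLike {p : ℕ} (hp : 1 ≤ p) :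
    IsTileCountingFunction (catalanLike p) := by
  have h3 : 0 < √3 := by positivity
  refine ⟨2 * √3, shape 0 '' specs p, by positivity, (specs_finite p).image _, ?_, fun n => ?_⟩
  · rintro _ ⟨s, hs, rfl⟩
    exact (specs_good s hs).isTallTile
  · rw [numTilings_eq_encard_paths specs_good (by positivity), paths_eq_image,
      Function.Injective.encard_image, Set.encard_coe_eq_coe_finsetCard,
      card_words_eq_catalanLike hp]
    exact fun v w h => mids_injective p 0 (List.cons.inj h).2

theorem catalanLike_eq {p : ℕ} (hp : 1 ≤ p) (n : ℕ) :
    catalanLike p n = catalan n * (1 + n * p ^ (2 * n)) := by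
  have h1 : (n + 1) * catalan n = (2 * n).choose n := by
    rw [succ_mul_catalan_eq_centralBinom, Nat.centralBinom]
  have h2 : (2 * n).choose (n + 1) = n * catalan n := by
    have h := Nat.choose_succ_right_eq (2 * n) n
    rw [← h1, show 2 * n - n = n by omega] at h
    apply Nat.eq_of_mul_eq_mul_right (Nat.succ_pos n)
    linarith
  have h3 : 1 ≤ p ^ (2 * n) := Nat.one_le_pow _ _ hp
  rw [catalanLike, h2, ← h1]
  zify [h3]
  ring

theorem emultiplicity_catalanLike {p : ℕ} (hp : p.Prime) (n : ℕ) :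
    emultiplicity p (catalanLike p n) = emultiplicity p (catalan n) := by
  have h : ¬ p ∣ 1 + n * p ^ (2 * n) := by
    rcases Nat.eq_zero_or_pos n with rfl | hn
    · simpa using hp.one_lt.ne'
    · rw [Nat.dvd_add_left (Dvd.dvd.mul_left (dvd_pow_self p (by omega)) n)]
      simpa using hp.one_lt.ne'
  rw [catalanLike_eq hp.one_le, emultiplicity_mul hp.prime, emultiplicity_eq_zero.2 h, add_zero]

end IrrationalTiling

/-- The order of `p` in `m` is `emultiplicity p m`, the largest `d` with `p ^ d ∣ m`
(and `⊤` for `m = 0`). -/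
theorem mainTheorem8 (p : ℕ) (hp : p.Prime) :
    (∃ f : ℕ → ℕ, IrrationalTiling.IsTileCountingFunction f ∧
      ∀ n : ℕ, emultiplicity p (f n) = emultiplicity p (catalan n)) ∧
    (IrrationalTiling.IsTileCountingFunction (IrrationalTiling.catalanLike p) ∧
      ∀ n : ℕ, emultiplicity p (IrrationalTiling.catalanLike p n) =
        emultiplicity p (catalan n)) := by
  have h := IrrationalTiling.isTileCountingFunction_catalanLike hp.one_le
  exact ⟨⟨_, h, IrrationalTiling.emultiplicity_catalanLike hp⟩, h,
    IrrationalTiling.emultiplicity_catalanLike hp⟩
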